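/- Let $n,n',d$ be positive integers, let $M_{n,d}$ be the set of multiindices $\alpha\in\mathbb{Z}_{\ge 0}^n$ with $\alpha_1+\dots+\alpha_n\le d$, let $\mathcal A\subset M_{n,d}\times\{1,\dots,n'\}$, and for $1\le j\le n'$ put $\mathcal A_j:=\{\alpha : (\alpha,j)\in\mathcal A\}$. Suppose that $\mathcal A$ is admissible, that is: 1. (Dimensionality) there is an integer $\#\mathcal A$ such that every $\mathcal A_j$ has exactly $\#\mathcal A$ elements; 2. (Scaling) there is an integer $|\mathcal A|$ such that $\sum_{j=1}^{n'}\sum_{\alpha\in\mathcal A_j}\alpha=(|\mathcal A|,\dots,|\mathcal A|)$; 3. (Strengthened spanning) if $\alpha_{1,j}<\alpha_{2,j}<\dots<\alpha_{\#\mathcal A,j}$ is the enumeration of $\mathcal A_j$ in the dictionary order (where $\alpha<\beta$ means $\alpha\ne\beta$ and $\alpha_i<\beta_i$ for the smallest $i$ with $\alpha_i\neq\beta_i$), then the vectors $\beta_i:=\sum_{j=1}^{n'}\alpha_{i,j}$, $1\le i\le\#\mathcal A$, span $\mathbb{R}^n$; 4. (Nondegeneracy) $(0,\dots,0)\in\mathcal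 A_j$ for every $j$. For a function $f$ on $\mathbb{R}^n\times\mathbb{R}^{n'}$ and $u\in\mathbb{R}^{\mathcal A}$ let $$T_{\mathcal A}f(u):=\int_{\mathbb{R}^n} f\Big(t,\ \sum_{\alpha\in\mathcal A_1}u_{(\alpha,1)}t^\alpha,\ \dots,\ \sum_{\alpha\in\mathcal A_{n'}}u_{(\alpha,n')}t^\alpha\Big)\,dt .$$ Then $T_{\mathcal A}$ is bounded from $L^p(\mathbb{R}^n\times\mathbb{R}^{n'})$ to $L^q(\mathbb{R}^{\mathcal A})$, where $p=\frac{|\mathcal A|+\#\mathcal A}{\#\mathcal A}$ and $q=|\mathcal A|+\#\mathcal A$: there is a constant $C<\infty$ such that for every $f\in L^p(\mathbb{R}^n\times\mathbb{R}^{n'})$ the integral defining $T_{\mathcal A}f(u)$ converges absolutely for almost every $u\in\mathbb{R}^{\mathcal A}$, and $T_{\mathcal A}f\in L^q(\mathbb{R}^{\mathcal A})$ with $\|T_{\mathcal A}f\|_{L^q(\mathbb{R}^{\mathcal A})}\le C\,\|f\|_{L^p(\mathbb{R}^n\times\mathbb{R}^{n'})}$. -/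

import Mathlib

open MeasureTheory
open scoped ENNReal NNReal

namespace PolyAvg

/-- The set `M_{n,d}` of multiindices of length `n` and degree at most `d`. -/
def multiIndices (n d : ℕ) : Set (Fin n → ℕ) :=
  {α | ∑ i, α i ≤ d}

/-- The monomial `t ^ α`. -/
noncomputable def monomial {n : ℕ} (t : Fin n → ℝ) (α : Fin n → ℕ) : ℝ :=
  ∏ i, t i ^ α i

/-- The slice `𝒜_j`: all multiindices `α` with `(α, j) ∈ 𝒜`. -/
def slice {n n' : ℕ} (A : Finset ((Fin n → ℕ) × Fin n')) (j : Fin n') :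
    Finset (Fin n → ℕ) :=
  (A.filter fun a => a.2 = j).image Prod.fst

/-- The slice `𝒜_j`, regarded as a finite set in the dictionary (lexicographic) order. -/
def lexSlice {n n' : ℕ} (A : Finset ((Fin n → ℕ) × Fin n')) (j : Fin n') :
    Finset (Lex (Fin n → ℕ)) :=
  (slice A j).map toLex.toEmbedding

theorem card_lexSlice {n n' : ℕ} (A : Finset ((Fin n → ℕ) × Fin n')) (j : Fin n') :
    (lexSlice A j).card = (slice A j).card :=
  Finset.card_map _

/-- If every slice of `𝒜` has `k` elements and `α_{1,j} < ⋯ < α_{k,j}` is the enumeration of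
`𝒜_j` in the dictionary order, then `beta A h i` is `β_i = ∑_j α_{i,j}`. -/
noncomputable def beta {n n' k : ℕ} (A : Finset ((Fin n → ℕ) × Fin n'))
    (h : ∀ j, (slice A j).card = k) (i : Fin k) : Fin n → ℕ :=
  ∑ j : Fin n', ofLex ((lexSlice A j).orderEmbOfFin ((card_lexSlice A j).trans (h j)) i)

/-- `𝒜` is admissible, with `#𝒜 = k` and `|𝒜| = m`. -/
structure IsAdmissible {n n' : ℕ} (A : Finset ((Fin n → ℕ) × Fin n')) (k m : ℕ) : Prop where
  /-- Dimensionality: every `𝒜_j` has cardinality `k`. -/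
  dimensionality : ∀ j, (slice A j).card = k
  /-- Scaling: the multiindices sum to `(m, …, m)`. -/
  scaling : ∑ j, ∑ α ∈ slice A j, α = fun _ => m
  /-- Strengthened spanning: `β_1, …, β_k` span `ℝⁿ`. -/
  spanning : Submodule.span ℝ
    (Set.range fun (i : Fin k) (l : Fin n) => (beta A dimensionality i l : ℝ)) = ⊤
  /-- Nondegeneracy: the zero multiindex belongs to every `𝒜_j`. -/
  nondegeneracy : ∀ j, (0 : Fin n → ℕ) ∈ slice A j

/-- The point `(t, ∑_{α ∈ 𝒜_1} u_{(α,1)} t^α, …, ∑_{α ∈ 𝒜_{n'}} u_{(α,n')} t^α)`. -/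
noncomputable def graphPoint {n n' : ℕ} (A : Finset ((Fin n → ℕ) × Fin n'))
    (u : A → ℝ) (t : Fin n → ℝ) : (Fin n → ℝ) × (Fin n' → ℝ) :=
  (t, fun j => ∑ a : A with a.1.2 = j, u a * monomial t a.1.1)

/-- The averaging operator `T_𝒜`. -/
noncomputable def averagingOp {n n' : ℕ} (A : Finset ((Fin n → ℕ) × Fin n'))
    (f : (Fin n → ℝ) × (Fin n' → ℝ) → ℂ) (u : A → ℝ) : ℂ :=
  ∫ t : Fin n → ℝ, f (graphPoint A u t)

end PolyAvg

/-! Write k = #𝒜, m = |𝒜|, p = (m+k)/k, and let V(t_1,…,t_k) be the product over j of the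
generalized Vandermonde determinants of the monomials in 𝒜_j. For fixed t_i, the map from u to the
values at t_1,…,t_k of the n' polynomials is linear with determinant V. By Tonelli and this change
of variables (`enorm_vandermonde_mul_lintegral_le`), the theorem reduces to (∫ g)^(m+k) ≤ C ∫ ∏
g(t_i)^p |V(t)| dt for g ≥ 0, applied to the restriction of |f| to each graph
(`exists_lintegral_rpow_le_vandermonde`).

As a function of its last point, V has dictionary-leading monomial t^β_k, with coefficient the same
determinant product for the first k-1 points. Iterating bounds the right side below by the product
over i of the infima of ∫ g^p |P| over P with leading term t^β_i (`prod_leadInf_le`). If P_i nearly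
attains the i-th infimum, with value b_i, Hölder with the weight ω = ∑ |P_i|/b_i leaves ∫ ω^(-k/m) ≤
C ∏ b_i^(1/m), uniformly in the lower-order terms of the P_i.

This is proved one variable at a time (`exists_lintegral_mul_prod_le`). If ∑ θ_i = k/m, then ∏
|P_i/b_i|^θ_i ≤ ω^(k/m). The choice θ_i = 1/m is critical in every variable because ∑ β_i = (m,…,m),
and spanning allows perturbations that make the degree in any chosen variable 1 ± η. In one variable
a polynomial is at least its leading coefficient times a power of the distance to the real parts of
its roots, and the minimum of |x|^(-1-η) and |x|^(-1+η) is integrable. -/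

namespace PolyAvg

/-! ### One-variable integrals controlled by leading coefficients -/

section OneVariable

open Polynomial Set

lemma lintegral_comp_abs_le (g : ℝ → ℝ≥0∞) :
    ∫⁻ x : ℝ, g |x| ≤ 2 * ∫⁻ x in Ioi (0 : ℝ), g x := by
  have h1 : ∫⁻ x in Ioi (0 : ℝ), g |x| = ∫⁻ x in Ioi (0 : ℝ), g x :=
    setLIntegral_congr_fun measurableSet_Ioi fun x hx => by
      simp only [abs_of_pos (mem_Ioi.1 hx)]
  have h2 : ∫⁻ x in Iic (0 : ℝ), g |x| = ∫⁻ x in Ici (0 : ℝ), g |x| := by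
    have := (Measure.measurePreserving_neg (volume : Measure ℝ)).setLIntegral_comp_preimage_emb
      (MeasurableEquiv.neg ℝ).measurableEmbedding (fun x => g |x|) (Ici 0)
    simpa using this
  have h3 : ∫⁻ x in Ici (0 : ℝ), g |x| = ∫⁻ x in Ioi (0 : ℝ), g |x| :=
    setLIntegral_congr Ioi_ae_eq_Ici.symm
  rw [← lintegral_add_compl _ measurableSet_Iic (μ := volume) (A := Iic (0 : ℝ)), compl_Iic, h2, h3,
    h1, two_mul]

lemma lintegral_min_rpow_le {a b η : ℝ} (ha : 0 < a) (hb : 0 < b) (hη : 0 < η) :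
    ∫⁻ x : ℝ, ENNReal.ofReal (min (a * |x| ^ (-1 - η)) (b * |x| ^ (-1 + η))) ≤
      ENNReal.ofReal (4 / η * (a ^ (1 / 2 : ℝ) * b ^ (1 / 2 : ℝ))) := by
  refine (lintegral_comp_abs_le
    (fun x => ENNReal.ofReal (min (a * x ^ (-1 - η)) (b * x ^ (-1 + η))))).trans ?_
  -- The crossover point, where a r^(-1-η) = b r^(-1+η); the second bound is used inside, the first
  -- outside.
  set r : ℝ := (a / b) ^ (1 / (2 * η)) with hr
  have hr0 : 0 < r := by positivity
  have hab : r ^ η = a ^ (1 / 2 : ℝ) / b ^ (1 / 2 : ℝ) := by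
    rw [hr, ← Real.rpow_mul (by positivity), ← Real.div_rpow ha.le hb.le]
    congr 1
    field_simp
  have hsa : a ^ (1 / 2 : ℝ) * a ^ (1 / 2 : ℝ) = a := by
    rw [← Real.rpow_add ha]; norm_num
  have hsb : b ^ (1 / 2 : ℝ) * b ^ (1 / 2 : ℝ) = b := by
    rw [← Real.rpow_add hb]; norm_num
  have hin : ∫⁻ x in Ioc 0 r, ENNReal.ofReal (min (a * x ^ (-1 - η)) (b * x ^ (-1 + η))) ≤
      ENNReal.ofReal (1 / η * (a ^ (1 / 2 : ℝ) * b ^ (1 / 2 : ℝ))) := by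
    have hint : IntegrableOn (fun x : ℝ => b * x ^ (-1 + η)) (Ioc 0 r) :=
      ((intervalIntegrable_iff_integrableOn_Ioc_of_le hr0.le).1
        (intervalIntegral.intervalIntegrable_rpow' (by linarith))).const_mul b
    calc _ ≤ ∫⁻ x in Ioc 0 r, ENNReal.ofReal (b * x ^ (-1 + η)) :=
          lintegral_mono fun x => ENNReal.ofReal_le_ofReal (min_le_right _ _)
      _ = ENNReal.ofReal (∫ x in Ioc 0 r, b * x ^ (-1 + η)) := by
          rw [ofReal_integral_eq_lintegral_ofReal hint]
          filter_upwards [ae_restrict_mem measurableSet_Ioc] with x hx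
          have := hx.1
          positivity
      _ ≤ _ := by
          rw [integral_const_mul, ← intervalIntegral.integral_of_le hr0.le,
            integral_rpow (Or.inl (by linarith))]
          refine ENNReal.ofReal_le_ofReal (le_of_eq ?_)
          rw [show -1 + η + 1 = η by ring, Real.zero_rpow hη.ne', hab]
          have : b ^ (1 / 2 : ℝ) ≠ 0 := by positivity
          nth_rewrite 1 [← hsb]
          field_simp
          ring
  have hout : ∫⁻ x in Ioi r, ENNReal.ofReal (min (a * x ^ (-1 - η)) (b * x ^ (-1 + η))) ≤
      ENNReal.ofReal (1 / η * (a ^ (1 / 2 : ℝ) * b ^ (1 / 2 : ℝ))) := by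
    have hint : IntegrableOn (fun x : ℝ => a * x ^ (-1 - η)) (Ioi r) :=
      (integrableOn_Ioi_rpow_of_lt (by linarith) hr0).const_mul a
    calc _ ≤ ∫⁻ x in Ioi r, ENNReal.ofReal (a * x ^ (-1 - η)) :=
          lintegral_mono fun x => ENNReal.ofReal_le_ofReal (min_le_left _ _)
      _ = ENNReal.ofReal (∫ x in Ioi r, a * x ^ (-1 - η)) := by
          rw [ofReal_integral_eq_lintegral_ofReal hint]
          filter_upwards [ae_restrict_mem measurableSet_Ioi] with x hx
          have := hr0.trans hx
          positivity
      _ ≤ _ := by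
          rw [integral_const_mul, integral_Ioi_rpow_of_lt (by linarith) hr0]
          refine ENNReal.ofReal_le_ofReal (le_of_eq ?_)
          rw [show -1 - η + 1 = -η by ring, Real.rpow_neg hr0.le, hab]
          have h1 : b ^ (1 / 2 : ℝ) ≠ 0 := by positivity
          have h2 : a ^ (1 / 2 : ℝ) ≠ 0 := by positivity
          nth_rewrite 1 [← hsa]
          field_simp
  rw [← Ioc_union_Ioi_eq_Ioi hr0.le]
  calc _ ≤ 2 * (ENNReal.ofReal (1 / η * (a ^ (1 / 2 : ℝ) * b ^ (1 / 2 : ℝ))) +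
        ENNReal.ofReal (1 / η * (a ^ (1 / 2 : ℝ) * b ^ (1 / 2 : ℝ)))) := by
        gcongr
        exact (lintegral_union_le _ _ _).trans (add_le_add hin hout)
    _ = _ := by
        rw [← ENNReal.ofReal_add (by positivity) (by positivity),
          show (2 : ℝ≥0∞) = ENNReal.ofReal 2 by simp, ← ENNReal.ofReal_mul (by norm_num)]
        congr 1
        ring

/-- Off the real parts of its complex roots, a real polynomial is bounded below in terms of its
leading coefficient. -/
lemma exists_finset_le_abs_eval (p : ℝ[X]) (d : ℕ) (hd : p.natDegree ≤ d) (h0 : p.coeff d ≠ 0) :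
    ∃ Z : Finset ℝ, Z.card ≤ d ∧ (d ≠ 0 → Z.Nonempty) ∧
      ∀ x δ : ℝ, 0 ≤ δ → (∀ z ∈ Z, δ ≤ |x - z|) → |p.coeff d| * δ ^ d ≤ |p.eval x| := by
  have hdeg : p.natDegree = d := le_antisymm hd (le_natDegree_of_ne_zero h0)
  set P : ℂ[X] := p.map (algebraMap ℝ ℂ) with hP
  have hPdeg : P.natDegree = d := by rw [hP, natDegree_map, hdeg]
  have hcard : P.roots.card = d := by
    rw [← hPdeg]; exact splits_iff_card_roots.1 (IsAlgClosed.splits P)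
  have hfac := (IsAlgClosed.splits P).eq_prod_roots
  classical
  refine ⟨(P.roots.map Complex.re).toFinset, ?_, ?_, ?_⟩
  · exact (Multiset.toFinset_card_le _).trans (by simp [hcard])
  · intro h
    rw [Multiset.toFinset_nonempty]
    intro h'
    apply h
    rw [← hcard, Multiset.map_eq_zero.1 h', Multiset.card_zero]
  · intro x δ hδ hx
    have hev : ((p.eval x : ℝ) : ℂ) = p.coeff d * (P.roots.map fun z => (x : ℂ) - z).prod := by
      have h1 : P.eval (x : ℂ) = ((p.eval x : ℝ) : ℂ) := by
        rw [hP, eval_map_algebraMap]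
        exact aeval_algebraMap_apply_eq_algebraMap_eval x p
      have h2 : P.leadingCoeff = (p.coeff d : ℂ) := by
        rw [leadingCoeff, hPdeg, hP, coeff_map]; rfl
      rw [← h1, ← h2]
      conv_lhs => rw [hfac]
      rw [eval_mul, eval_C, eval_multiset_prod, Multiset.map_map]
      simp
    have habs : |p.eval x| = |p.coeff d| * (P.roots.map fun z => ‖(x : ℂ) - z‖).prod := by
      have := congrArg norm hev
      rw [norm_mul, Complex.norm_real, Complex.norm_real, Real.norm_eq_abs, Real.norm_eq_abs] at this
      rw [this]
      congr 1
      have := map_multiset_prod (normHom : ℂ →*₀ ℝ) (P.roots.map fun z => (x : ℂ) - z)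
      rw [Multiset.map_map] at this
      exact this
    rw [habs]
    gcongr
    have : ∀ s : Multiset ℂ, (∀ z ∈ s, δ ≤ |x - z.re|) →
        δ ^ s.card ≤ (s.map fun z => ‖(x : ℂ) - z‖).prod := by
      intro s
      induction s using Multiset.induction_on with
      | empty => simp
      | cons z s ih =>
        intro h
        rw [Multiset.card_cons, Multiset.map_cons, Multiset.prod_cons, pow_succ']
        refine mul_le_mul ?_ (ih fun w hw => h w (Multiset.mem_cons_of_mem hw)) (by positivity)
          (norm_nonneg _)
        refine (h z (Multiset.mem_cons_self z s)).trans ?_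
        simpa using Complex.abs_re_le_norm ((x : ℂ) - z)
    have h3 := this P.roots fun z hz => hx z.re (by
      rw [Multiset.mem_toFinset]; exact Multiset.mem_map_of_mem _ hz)
    rwa [hcard] at h3

/-- One-variable estimate for weights that are slightly sub- and supercritical. -/
lemma exists_lintegral_mul_prod_coeff_le {ι : Type*} [Fintype ι] (d : ι → ℕ) {η : ℝ} (hη : 0 < η)
    (hη1 : η < 1) :
    ∃ C : ℝ≥0, ∀ (p : ι → ℝ[X]) (θ₁ θ₂ : ι → ℝ) (h : ℝ → ℝ≥0∞) (B : ℝ≥0),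
      (∀ i, (p i).natDegree ≤ d i) → (∀ i, 0 < θ₁ i) → (∀ i, 0 < θ₂ i) →
      ∑ i, θ₁ i * d i = 1 + η → ∑ i, θ₂ i * d i = 1 - η →
      (∀ x, h x * ∏ i, ‖(p i).eval x‖ₑ ^ θ₁ i ≤ B) →
      (∀ x, h x * ∏ i, ‖(p i).eval x‖ₑ ^ θ₂ i ≤ B) →
      (∫⁻ x, h x) * ∏ i, ‖(p i).coeff (d i)‖ₑ ^ ((θ₁ i + θ₂ i) / 2) ≤ C * B := by
  classical
  -- There are at most ∑ d_i centres, and each contributes the factor 4/η of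
  -- `lintegral_min_rpow_le`.
  refine ⟨Real.toNNReal ((∑ i, d i : ℕ) * (4 / η)), fun p θ₁ θ₂ h B hdeg h₁ h₂ hs₁ hs₂ hh₁ hh₂ => ?_⟩
  by_cases h0 : ∃ i, (p i).coeff (d i) = 0
  · obtain ⟨i, hi⟩ := h0
    rw [Finset.prod_eq_zero (Finset.mem_univ i), mul_zero]
    · exact zero_le
    · rw [hi, enorm_zero, ENNReal.zero_rpow_of_pos (by linarith [h₁ i, h₂ i])]
  push Not at h0
  choose Z hZc hZn hZ using fun i => exists_finset_le_abs_eval (p i) (d i) (hdeg i) (h0 i)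
  set W : Finset ℝ := Finset.univ.biUnion Z with hW
  have hWc : W.card ≤ ∑ i, d i := Finset.card_biUnion_le.trans (Finset.sum_le_sum fun i _ => hZc i)
  have hWn : W.Nonempty := by
    by_contra hne
    have : ∀ i, d i = 0 := by
      intro i
      by_contra hi
      obtain ⟨z, hz⟩ := hZn i hi
      exact hne ⟨z, Finset.mem_biUnion.2 ⟨i, Finset.mem_univ i, hz⟩⟩
    simp [this] at hs₁
    linarith
  set a : (ι → ℝ) → ℝ := fun θ => ∏ i, |(p i).coeff (d i)| ^ θ i with ha
  have ha0 : ∀ θ, 0 < a θ := fun θ =>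
    Finset.prod_pos fun i _ => Real.rpow_pos_of_pos (abs_pos.2 (h0 i)) _
  have key : ∀ (θ : ι → ℝ) (S : ℝ), (∀ i, 0 < θ i) → ∑ i, θ i * d i = S →
      (∀ x, h x * ∏ i, ‖(p i).eval x‖ₑ ^ θ i ≤ B) → ∀ x δ, 0 < δ → (∀ z ∈ W, δ ≤ |x - z|) →
      h x ≤ B * ENNReal.ofReal ((a θ)⁻¹ * δ ^ (-S)) := by
    intro θ S hθ hS hh x δ hδ hx
    have hle : ENNReal.ofReal (a θ * δ ^ S) ≤ ∏ i, ‖(p i).eval x‖ₑ ^ θ i := by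
      have : a θ * δ ^ S = ∏ i, (|(p i).coeff (d i)| * δ ^ d i) ^ θ i := by
        rw [← hS, Real.rpow_sum_of_pos hδ, ha, ← Finset.prod_mul_distrib]
        refine Finset.prod_congr rfl fun i _ => ?_
        rw [Real.mul_rpow (abs_nonneg _) (by positivity), ← Real.rpow_natCast,
          ← Real.rpow_mul hδ.le, mul_comm (θ i)]
      rw [this, ENNReal.ofReal_prod_of_nonneg fun i _ => by positivity]
      refine Finset.prod_le_prod' fun i _ => ?_
      rw [Real.enorm_eq_ofReal_abs, ENNReal.ofReal_rpow_of_nonneg (abs_nonneg _) (hθ i).le]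
      refine ENNReal.ofReal_le_ofReal (Real.rpow_le_rpow (by positivity) ?_ (hθ i).le)
      exact hZ i x δ hδ.le fun z hz => hx z (Finset.mem_biUnion.2 ⟨i, Finset.mem_univ i, hz⟩)
    have hpos : 0 < a θ * δ ^ S := mul_pos (ha0 θ) (by positivity)
    have h3 := (mul_le_mul_right hle (h x)).trans (hh x)
    rw [Real.rpow_neg hδ.le, ← mul_inv, ENNReal.ofReal_inv_of_pos hpos, ← div_eq_mul_inv]
    exact (ENNReal.le_div_iff_mul_le (Or.inl (by simpa using hpos)) (Or.inl (by simp))).2 h3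
  have hbound : ∀ x, x ∉ W → h x ≤ ∑ z ∈ W, (B : ℝ≥0∞) * ENNReal.ofReal
      (min ((a θ₁)⁻¹ * |x - z| ^ (-1 - η)) ((a θ₂)⁻¹ * |x - z| ^ (-1 + η))) := by
    intro x hx
    -- Both bounds hold with δ the distance to the nearest centre; summing over all centres removes
    -- the dependence of that centre on x.
    obtain ⟨z, hzW, hz⟩ := W.exists_min_image (fun z => |x - z|) hWn
    have hpos : 0 < |x - z| := abs_pos.2 (sub_ne_zero.2 fun h => hx (h ▸ hzW))
    refine le_trans ?_ (Finset.single_le_sum (f := fun z => (B : ℝ≥0∞) * ENNReal.ofReal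
      (min ((a θ₁)⁻¹ * |x - z| ^ (-1 - η)) ((a θ₂)⁻¹ * |x - z| ^ (-1 + η))))
      (fun _ _ => zero_le) hzW)
    rcases min_choice ((a θ₁)⁻¹ * |x - z| ^ (-1 - η)) ((a θ₂)⁻¹ * |x - z| ^ (-1 + η)) with hm | hm
    · rw [hm, show -1 - η = -(1 + η) by ring]
      exact key θ₁ _ h₁ hs₁ hh₁ x _ hpos hz
    · rw [hm, show -1 + η = -(1 - η) by ring]
      exact key θ₂ _ h₂ hs₂ hh₂ x _ hpos hz
  set D : ℝ := (a θ₁)⁻¹ ^ (1 / 2 : ℝ) * (a θ₂)⁻¹ ^ (1 / 2 : ℝ) with hD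
  have hD0 : 0 < D := by have := ha0 θ₁; have := ha0 θ₂; positivity
  have hint : ∫⁻ x, h x ≤ (∑ i, d i : ℕ) * (B * ENNReal.ofReal (4 / η * D)) := by
    calc ∫⁻ x, h x ≤ ∫⁻ x, ∑ z ∈ W, (B : ℝ≥0∞) * ENNReal.ofReal
          (min ((a θ₁)⁻¹ * |x - z| ^ (-1 - η)) ((a θ₂)⁻¹ * |x - z| ^ (-1 + η))) := by
          refine lintegral_mono_ae ?_
          have : (W : Set ℝ)ᶜ ∈ ae volume := compl_mem_ae_iff.2 (W.finite_toSet.measure_zero _)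
          filter_upwards [this] with x hx
          exact hbound x hx
      _ = ∑ z ∈ W, B * ∫⁻ x, ENNReal.ofReal
          (min ((a θ₁)⁻¹ * |x| ^ (-1 - η)) ((a θ₂)⁻¹ * |x| ^ (-1 + η))) := by
          rw [lintegral_finsetSum' _ fun z _ => by fun_prop]
          refine Finset.sum_congr rfl fun z _ => ?_
          rw [lintegral_const_mul' _ _ ENNReal.coe_ne_top]
          congr 1
          exact lintegral_sub_right_eq_self (fun x => ENNReal.ofReal
            (min ((a θ₁)⁻¹ * |x| ^ (-1 - η)) ((a θ₂)⁻¹ * |x| ^ (-1 + η)))) z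
      _ ≤ ∑ z ∈ W, B * ENNReal.ofReal (4 / η * D) := by
          gcongr
          exact lintegral_min_rpow_le (inv_pos.2 (ha0 _)) (inv_pos.2 (ha0 _)) hη
      _ ≤ _ := by
          rw [Finset.sum_const, nsmul_eq_mul]
          gcongr
  have hprod : ∏ i, ‖(p i).coeff (d i)‖ₑ ^ ((θ₁ i + θ₂ i) / 2) = ENNReal.ofReal D⁻¹ := by
    have : D⁻¹ = ∏ i, |(p i).coeff (d i)| ^ ((θ₁ i + θ₂ i) / 2) := by
      rw [hD, mul_inv, ← Real.inv_rpow (inv_nonneg.2 (ha0 _).le),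
        ← Real.inv_rpow (inv_nonneg.2 (ha0 _).le), inv_inv, inv_inv, ha,
        ← Real.finsetProd_rpow _ _ fun i _ => by positivity,
        ← Real.finsetProd_rpow _ _ fun i _ => by positivity, ← Finset.prod_mul_distrib]
      refine Finset.prod_congr rfl fun i _ => ?_
      rw [← Real.rpow_mul (abs_nonneg _), ← Real.rpow_mul (abs_nonneg _),
        ← Real.rpow_add (abs_pos.2 (h0 i))]
      congr 1
      ring
    rw [this, ENNReal.ofReal_prod_of_nonneg fun i _ => by positivity]
    refine Finset.prod_congr rfl fun i _ => ?_
    rw [Real.enorm_eq_ofReal_abs, ENNReal.ofReal_rpow_of_nonneg (abs_nonneg _)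
      (by linarith [h₁ i, h₂ i])]
  rw [hprod]
  calc _ ≤ (∑ i, d i : ℕ) * (B * ENNReal.ofReal (4 / η * D)) * ENNReal.ofReal D⁻¹ := by gcongr
    _ = (∑ i, d i : ℕ) * B * (ENNReal.ofReal (4 / η * D) * ENNReal.ofReal D⁻¹) := by ring
    _ = _ := by
      rw [← ENNReal.ofReal_mul (by positivity), mul_assoc (4 / η), mul_inv_cancel₀ hD0.ne', mul_one,
        ENNReal.ofNNReal_toNNReal, ENNReal.ofReal_mul (by positivity), ENNReal.ofReal_natCast]
      ring

end OneVariable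
-- Dictionary-order leading terms and iterated integration
section LexLead

open Polynomial

/-- `LexLead n β c P` says that `P` is a function on `ℝⁿ` which, as an iterated polynomial in its
variables, has leading term `c t ^ β` with respect to the dictionary order. -/
def LexLead : (n : ℕ) → (Fin n → ℕ) → ℝ → ((Fin n → ℝ) → ℝ) → Prop
  | 0, _, c, P => P = fun _ => c
  | n + 1, β, c, P => ∃ Q, LexLead n (Fin.tail β) c Q ∧ ∀ t : Fin n → ℝ, ∃ p : ℝ[X],
      p.natDegree ≤ β 0 ∧ p.coeff (β 0) = Q t ∧ ∀ x : ℝ, P (Fin.cons x t) = p.eval x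

lemma LexLead.mul : ∀ {n : ℕ} {β β' : Fin n → ℕ} {c c' : ℝ} {P P' : (Fin n → ℝ) → ℝ},
    LexLead n β c P → LexLead n β' c' P' → LexLead n (β + β') (c * c') (P * P')
  | 0, _, _, _, _, _, _, h, h' => by
    simp only [LexLead] at h h' ⊢
    rw [h, h']; rfl
  | n + 1, β, β', c, c', P, P', ⟨Q, hQ, hP⟩, ⟨Q', hQ', hP'⟩ => by
    refine ⟨Q * Q', hQ.mul hQ', fun t => ?_⟩
    obtain ⟨p, h1, h2, h3⟩ := hP t
    obtain ⟨p', h1', h2', h3'⟩ := hP' t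
    refine ⟨p * p', natDegree_mul_le.trans (add_le_add h1 h1'), ?_, fun x => ?_⟩
    · rw [Pi.add_apply, coeff_mul_add_eq_of_natDegree_le h1 h1', h2, h2', Pi.mul_apply]
    · rw [Pi.mul_apply, h3, h3', eval_mul]

lemma LexLead.const (c : ℝ) : ∀ n : ℕ, LexLead n 0 c fun _ => c
  | 0 => rfl
  | n + 1 => ⟨fun _ => c, LexLead.const c n, fun _ => ⟨C c, by simp, by simp, fun x => by simp⟩⟩

lemma LexLead.eq_const : ∀ {n : ℕ} {c : ℝ} {P : (Fin n → ℝ) → ℝ}, LexLead n 0 c P → P = fun _ => c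
  | 0, _, _, h => h
  | n + 1, c, P, ⟨Q, hQ, hP⟩ => by
    have hQc : Q = fun _ => c := LexLead.eq_const hQ
    funext t
    obtain ⟨p, h1, h2, h3⟩ := hP (Fin.tail t)
    have h4 := h3 (t 0)
    rw [Fin.cons_self_tail] at h4
    have hp : p = C (p.coeff 0) := eq_C_of_natDegree_le_zero h1
    rw [h4, hp, eval_C]
    exact h2.trans (by rw [hQc])

lemma LexLead.const_mul {n : ℕ} {β : Fin n → ℕ} {c : ℝ} {P : (Fin n → ℝ) → ℝ} (a : ℝ)
    (h : LexLead n β c P) : LexLead n β (a * c) fun t => a * P t := by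
  have := (LexLead.const a n).mul h
  rwa [zero_add] at this

lemma LexLead.prod {n : ℕ} {ι : Type*} (s : Finset ι) {β : ι → Fin n → ℕ} {c : ι → ℝ}
    {P : ι → (Fin n → ℝ) → ℝ} (h : ∀ i ∈ s, LexLead n (β i) (c i) (P i)) :
    LexLead n (∑ i ∈ s, β i) (∏ i ∈ s, c i) fun t => ∏ i ∈ s, P i t := by
  classical
  induction s using Finset.induction_on with
  | empty => simpa using LexLead.const 1 n
  | insert a s ha ih =>
    have := (h a (Finset.mem_insert_self a s)).mul
      (ih fun i hi => h i (Finset.mem_insert_of_mem hi))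
    rw [Finset.sum_insert ha, Finset.prod_insert ha]
    convert this using 1
    funext t
    simp [Finset.prod_insert ha]

lemma monomial_cons {n : ℕ} (x : ℝ) (t : Fin n → ℝ) (α : Fin (n + 1) → ℕ) :
    monomial (Fin.cons x t) α = x ^ α 0 * monomial t (Fin.tail α) := by
  simp [monomial, Fin.prod_univ_succ, Fin.tail]

lemma toLex_lt_toLex_iff_tail {n : ℕ} (α γ : Fin (n + 1) → ℕ) :
    toLex γ < toLex α ↔ γ 0 < α 0 ∨ γ 0 = α 0 ∧ toLex (Fin.tail γ) < toLex (Fin.tail α) := by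
  constructor
  · rintro ⟨i, hi, hlt⟩
    induction i using Fin.cases with
    | zero => exact Or.inl hlt
    | succ i =>
      exact Or.inr ⟨hi 0 (Fin.succ_pos i), i, fun j hj => hi j.succ (Fin.succ_lt_succ_iff.2 hj), hlt⟩
  · rintro (h | ⟨h, i, hi, hlt⟩)
    · exact ⟨0, fun j hj => absurd hj (Fin.not_lt_zero j), h⟩
    · refine ⟨i.succ, fun j hj => ?_, hlt⟩
      induction j using Fin.cases with
      | zero => exact h
      | succ j => exact hi j (Fin.succ_lt_succ_iff.1 hj)

/-- Only monomials sharing the first exponent of α reach the coefficient of the top power of the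
first variable, and their tails precede that of α, so the recursion closes. The coefficient c may
vanish. -/
lemma lexLead_monomial_add_sum {ι : Type*} : ∀ {n : ℕ} (α : Fin n → ℕ) (c : ℝ) (s : Finset ι)
    (γ : ι → Fin n → ℕ) (e : ι → ℝ), (∀ l ∈ s, toLex (γ l) < toLex α) →
    LexLead n α c fun t => c * monomial t α + ∑ l ∈ s, e l * monomial t (γ l)
  | 0, α, c, s, γ, e, h => by
    have : s = ∅ := Finset.eq_empty_of_forall_notMem fun l hl => by
      obtain ⟨i, -⟩ := h l hl
      exact i.elim0
    subst this
    simp [LexLead, monomial]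
  | n + 1, α, c, s, γ, e, h => by
    refine ⟨_, lexLead_monomial_add_sum (Fin.tail α) c (s.filter fun l => γ l 0 = α 0)
      (fun l => Fin.tail (γ l)) e fun l hl => ?_, fun t => ?_⟩
    · rw [Finset.mem_filter] at hl
      rcases (toLex_lt_toLex_iff_tail _ _).1 (h l hl.1) with h' | h'
      · exact absurd hl.2 h'.ne
      · exact h'.2
    · refine ⟨C (c * monomial t (Fin.tail α)) * X ^ α 0 +
        ∑ l ∈ s, C (e l * monomial t (Fin.tail (γ l))) * X ^ γ l 0, ?_, ?_, fun x => ?_⟩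
      · refine natDegree_add_le_of_degree_le (natDegree_C_mul_X_pow_le _ _)
          (natDegree_sum_le_of_forall_le _ _ fun l hl => (natDegree_C_mul_X_pow_le _ _).trans ?_)
        rcases (toLex_lt_toLex_iff_tail _ _).1 (h l hl) with h' | h'
        · exact h'.le
        · exact h'.1.le
      · simp only [coeff_add, finsetSum_coeff, coeff_C_mul, coeff_X_pow, Finset.sum_filter,
          mul_ite, mul_one, mul_zero, if_true, eq_comm]
      · rw [eval_add, eval_finsetSum]
        simp only [eval_mul, eval_C, eval_pow, eval_X, monomial_cons]
        congr 1
        · ring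
        · exact Finset.sum_congr rfl fun l _ => by ring

/-- Induction on variables. The hypothesis is imposed on a whole cube of exponents: the faces s_0 =
±1 feed the one-variable estimate, whose conclusion carries the averaged exponent s_0 = 0, so the
cube in the remaining variables survives. -/
lemma exists_lintegral_mul_prod_le {ι : Type*} [Fintype ι] {η : ℝ} (hη : 0 < η) (hη1 : η < 1) :
    ∀ (n : ℕ) (β : ι → Fin n → ℕ), ∃ C : ℝ≥0, ∀ (P : ι → (Fin n → ℝ) → ℝ) (c θ : ι → ℝ)
      (w : Fin n → ι → ℝ) (H : (Fin n → ℝ) → ℝ≥0∞) (B : ℝ≥0),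
      (∀ i, LexLead n (β i) (c i) (P i)) → Measurable H →
      (∀ s : Fin n → ℝ, (∀ l, |s l| ≤ 1) → ∀ i, 0 < θ i + ∑ l, s l * w l i) →
      (∀ l, ∑ i, θ i * β i l = 1) →
      (∀ l l', ∑ i, w l i * β i l' = if l = l' then η else 0) →
      (∀ s : Fin n → ℝ, (∀ l, |s l| ≤ 1) → ∀ t,
        H t * ∏ i, ‖P i t‖ₑ ^ (θ i + ∑ l, s l * w l i) ≤ B) →
      (∫⁻ t, H t) * ∏ i, ‖c i‖ₑ ^ θ i ≤ C * B
  | 0, β => by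
    refine ⟨1, fun P c θ w H B hP hH hθ h1 hw hHB => ?_⟩
    have h := hHB 0 (by simp) default
    have hPc : ∀ i t, P i t = c i := fun i t => by
      have := hP i
      simp only [LexLead] at this
      rw [this]
    simp only [hPc, Finset.univ_eq_empty, Finset.sum_empty, add_zero] at h
    rw [lintegral_unique, volume_pi, Measure.pi_univ, Finset.univ_eq_empty, Finset.prod_empty,
      mul_one, ENNReal.coe_one, one_mul]
    convert h
  | n + 1, β => by
    obtain ⟨C₁, hC₁⟩ := exists_lintegral_mul_prod_coeff_le (fun i => β i 0) hη hη1
    obtain ⟨C₂, hC₂⟩ := exists_lintegral_mul_prod_le hη hη1 n fun i => Fin.tail (β i)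
    refine ⟨C₂ * C₁, fun P c θ w H B hP hH hθ h1 hw hHB => ?_⟩
    choose Q hQ hPQ using hP
    have hcube : ∀ (a : ℝ) (s : Fin n → ℝ), |a| ≤ 1 → (∀ l, |s l| ≤ 1) →
        ∀ l, |(Fin.cons a s : Fin (n + 1) → ℝ) l| ≤ 1 := by
      intro a s ha hs l
      induction l using Fin.cases with
      | zero => simpa using ha
      | succ l => simpa using hs l
    have hmp := (volume_preserving_piFinSuccAbove (fun _ : Fin (n + 1) => ℝ) 0).symm
    have hcons : Measurable fun y : ℝ × (Fin n → ℝ) => (Fin.cons y.1 y.2 : Fin (n + 1) → ℝ) := by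
      refine measurable_pi_iff.2 fun l => ?_
      induction l using Fin.cases with
      | zero => simpa using measurable_fst
      | succ l => exact (measurable_pi_apply l).comp measurable_snd
    have hH' : Measurable fun y : ℝ × (Fin n → ℝ) => H (Fin.cons y.1 y.2) := hH.comp hcons
    have hfub : ∫⁻ t, H t = ∫⁻ t : Fin n → ℝ, ∫⁻ x : ℝ, H (Fin.cons x t) := by
      rw [← hmp.lintegral_comp_emb (MeasurableEquiv.measurableEmbedding _), Measure.volume_eq_prod,
        lintegral_prod_symm]
      · simp [MeasurableEquiv.piFinSuccAbove, Fin.insertNthEquiv]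
      · refine Measurable.aemeasurable ?_
        simpa [MeasurableEquiv.piFinSuccAbove, Fin.insertNthEquiv] using hH'
    rw [hfub]
    -- The inner integral in the first variable takes the role of H, with bound C₁ * B.
    have key := hC₂ Q c θ (fun l => w l.succ) (fun t => ∫⁻ x : ℝ, H (Fin.cons x t)) (C₁ * B) hQ
      hH'.lintegral_prod_left' ?_ (fun l => h1 l.succ) ?_ ?_
    · refine key.trans (le_of_eq ?_)
      push_cast
      ring
    · intro s hs i
      simpa [Fin.sum_univ_succ] using hθ (Fin.cons 0 s) (hcube 0 s (by simp) hs) i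
    · intro l l'
      simpa [Fin.tail] using hw l.succ l'.succ
    · intro s hs t
      choose p hp1 hp2 hp3 using fun i => hPQ i t
      have hpos := hθ (Fin.cons 1 s) (hcube 1 s (by simp) hs)
      have hneg := hθ (Fin.cons (-1) s) (hcube (-1) s (by simp) hs)
      -- Only w_0 has a nonzero moment against β_i(0), so the weighted degree in the first variable
      -- depends on a alone.
      have hsum : ∀ a : ℝ, ∑ i, (θ i + ∑ l, (Fin.cons a s : Fin (n + 1) → ℝ) l * w l i) *
          (β i 0 : ℝ) = 1 + a * η := by
        intro a
        simp only [add_mul, Finset.sum_add_distrib, h1 0, Finset.sum_mul]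
        rw [Finset.sum_comm]
        simp only [mul_assoc, ← Finset.mul_sum, hw]
        simp
      have := hC₁ p _ _ (fun x => H (Fin.cons x t)) B hp1 hpos hneg
        (by rw [hsum, one_mul]) (by rw [hsum]; ring)
        (fun x => by simpa only [hp3] using hHB _ (hcube 1 s (by simp) hs) (Fin.cons x t))
        (fun x => by simpa only [hp3] using hHB _ (hcube (-1) s (by simp) hs) (Fin.cons x t))
      push_cast
      convert this using 3 with i
      rw [hp2]
      congr 1
      simp only [Fin.sum_univ_succ, Fin.cons_zero, Fin.cons_succ]
      ring

end LexLead
-- Weighted integrals bounding the integral of g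
section Nonconcentration

lemma exists_weights {n : ℕ} {ι : Type*} [Fintype ι] {m : ℕ} (hm : 0 < m)
    (β : ι → Fin n → ℕ) (i₀ : ι) (h0 : β i₀ = 0)
    (hspan : Submodule.span ℝ (Set.range fun (i : ι) (l : Fin n) => (β i l : ℝ)) = ⊤) :
    ∃ η : ℝ, 0 < η ∧ η < 1 ∧ ∃ w : Fin n → ι → ℝ,
      (∀ l l', ∑ i, w l i * β i l' = if l = l' then η else 0) ∧ (∀ l, ∑ i, w l i = 0) ∧
      ∀ s : Fin n → ℝ, (∀ l, |s l| ≤ 1) → ∀ i, 0 < (m : ℝ)⁻¹ + ∑ l, s l * w l i := by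
  classical
  have hex : ∀ l : Fin n, ∃ x : ι → ℝ,
      ∑ i, x i • (fun l' => (β i l' : ℝ)) = Pi.single l (1 : ℝ) := fun l =>
    (Submodule.mem_span_range_iff_exists_fun ℝ).1 (hspan ▸ Submodule.mem_top)
  choose x hx using hex
  -- As β_{i₀} = 0, the i₀ entry can be altered freely to give total mass zero without changing the
  -- moments against β.
  set y : Fin n → ι → ℝ := fun l i => x l i - if i = i₀ then ∑ i', x l i' else 0 with hy
  have hy0 : ∀ l, ∑ i, y l i = 0 := fun l => by simp [hy]
  have hy1 : ∀ l l', ∑ i, y l i * β i l' = if l = l' then 1 else 0 := by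
    intro l l'
    have h1 := congrFun (hx l) l'
    simp only [Finset.sum_apply, Pi.smul_apply, smul_eq_mul, Pi.single_apply] at h1
    simp only [hy, sub_mul, Finset.sum_sub_distrib, h1, ite_mul, zero_mul, Finset.sum_ite_eq',
      Finset.mem_univ, if_true, h0]
    simp [eq_comm]
  set S : ℝ := ∑ l, ∑ i, |y l i| with hS
  have hS0 : 0 ≤ S := Finset.sum_nonneg fun l _ => Finset.sum_nonneg fun i _ => abs_nonneg _
  have hm' : (0 : ℝ) < m := by exact_mod_cast hm
  have hm1 : (1 : ℝ) ≤ m := by exact_mod_cast hm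
  -- This scale keeps every perturbation below 1/m and makes η < 1.
  have hden : 0 < m * (S + 2) := by positivity
  refine ⟨(m * (S + 2))⁻¹, by positivity, ?_, fun l i => (m * (S + 2))⁻¹ * y l i, ?_, ?_, ?_⟩
  · exact inv_lt_one_of_one_lt₀ (by nlinarith)
  · intro l l'
    simp only [mul_assoc, ← Finset.mul_sum, hy1]
    simp
  · intro l
    rw [← Finset.mul_sum, hy0, mul_zero]
  · intro s hs i
    have h1 : |∑ l, s l * ((m * (S + 2))⁻¹ * y l i)| ≤ (m * (S + 2))⁻¹ * S := by
      refine (Finset.abs_sum_le_sum_abs _ _).trans ?_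
      rw [hS, Finset.mul_sum]
      refine Finset.sum_le_sum fun l _ => ?_
      rw [abs_mul, abs_mul, abs_of_pos (inv_pos.2 hden)]
      have h2 : |y l i| ≤ ∑ i, |y l i| :=
        Finset.single_le_sum (f := fun i => |y l i|) (fun _ _ => abs_nonneg _) (Finset.mem_univ i)
      calc |s l| * ((m * (S + 2))⁻¹ * |y l i|) ≤ 1 * ((m * (S + 2))⁻¹ * ∑ i, |y l i|) := by
            gcongr
            exact hs l
        _ = _ := one_mul _
    have h3 : (m * (S + 2))⁻¹ * S < (m : ℝ)⁻¹ := by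
      rw [mul_inv, mul_assoc]
      refine mul_lt_of_lt_one_right (by positivity) ?_
      rw [inv_mul_lt_iff₀ (by positivity)]
      linarith
    linarith [neg_abs_le (∑ l, s l * ((m * (S + 2))⁻¹ * y l i))]

lemma prod_rpow_le_rpow_sum {ι : Type*} (s : Finset ι) (a : ι → ℝ≥0∞) (θ : ι → ℝ) {x : ℝ≥0∞}
    (hx0 : x ≠ 0) (hx : x ≠ ∞) (ha : ∀ i ∈ s, a i ≤ x) (hθ : ∀ i ∈ s, 0 ≤ θ i) :
    ∏ i ∈ s, a i ^ θ i ≤ x ^ ∑ i ∈ s, θ i := by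
  classical
  induction s using Finset.induction_on with
  | empty => simp
  | insert i s hi ih =>
    rw [Finset.prod_insert hi, Finset.sum_insert hi, ENNReal.rpow_add _ _ hx0 hx]
    exact mul_le_mul' (ENNReal.rpow_le_rpow (ha i (Finset.mem_insert_self i s))
      (hθ i (Finset.mem_insert_self i s))) (ih (fun j hj => ha j (Finset.mem_insert_of_mem hj))
        fun j hj => hθ j (Finset.mem_insert_of_mem hj))

/-- A function with finite weighted integrals against functions `P i` with leading terms `t ^ β i`
has controlled integral. -/
lemma exists_lintegral_rpow_le_prod {n k m : ℕ} (hk : 0 < k) (hm : 0 < m)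
    (β : Fin k → Fin n → ℕ) (i₀ : Fin k) (h0 : β i₀ = 0)
    (hspan : Submodule.span ℝ (Set.range fun (i : Fin k) (l : Fin n) => (β i l : ℝ)) = ⊤)
    (hsum : ∀ l, ∑ i, β i l = m) :
    ∃ C : ℝ≥0, ∀ (P : Fin k → (Fin n → ℝ) → ℝ) (g : (Fin n → ℝ) → ℝ≥0∞) (b : Fin k → ℝ),
      (∀ i, LexLead n (β i) 1 (P i)) → (∀ i, Measurable (P i)) → Measurable g → (∀ i, 0 < b i) →
      (∀ i, ∫⁻ t, g t ^ (((m : ℝ) + k) / k) * ‖P i t‖ₑ ≤ ENNReal.ofReal (b i)) →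
      (∫⁻ t, g t) ^ ((m : ℝ) + k) ≤ C * ∏ i, ENNReal.ofReal (b i) := by
  obtain ⟨η, hη, hη1, w, hw, hw0, hpos⟩ := exists_weights hm β i₀ h0 hspan
  obtain ⟨C, hC⟩ := exists_lintegral_mul_prod_le hη hη1 n β
  have hm' : (0 : ℝ) < m := by exact_mod_cast hm
  have hk' : (0 : ℝ) < k := by exact_mod_cast hk
  -- Raising Hölder's inequality to the power m+k turns k^(1/p) into k^k and the conjugate factor
  -- C^(m/(m+k)) into C^m.
  refine ⟨k ^ (k : ℝ) * C ^ (m : ℝ), fun P g b hP hPm hg hb hgb => ?_⟩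
  set ω : (Fin n → ℝ) → ℝ≥0∞ := fun t => ∑ i, ‖(b i)⁻¹ * P i t‖ₑ with hω
  have hωm : Measurable ω := by
    refine Finset.measurable_sum _ fun i _ => ?_
    exact ((hPm i).const_mul _).enorm
  have hωtop : ∀ t, ω t ≠ ∞ := fun t => (ENNReal.sum_lt_top.2 fun i _ => enorm_lt_top).ne
  have hωle : ∀ t i, ‖(b i)⁻¹ * P i t‖ₑ ≤ ω t := fun t i =>
    Finset.single_le_sum (f := fun i => ‖(b i)⁻¹ * P i t‖ₑ) (fun _ _ => zero_le)
      (Finset.mem_univ i)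
  -- Nondegeneracy enters: P_{i₀} is the constant 1, so ω never vanishes and negative powers are
  -- harmless.
  have hω0 : ∀ t, ω t ≠ 0 := by
    intro t h
    have h1 := hωle t i₀
    have h2 := hP i₀
    rw [h0] at h2
    rw [h, h2.eq_const, nonpos_iff_eq_zero, enorm_eq_zero, mul_one] at h1
    exact (inv_pos.2 (hb i₀)).ne' h1
  have hH : (∫⁻ t, ω t ^ (-(k / m : ℝ))) * ∏ i, ‖(b i)⁻¹‖ₑ ^ (m : ℝ)⁻¹ ≤ C * (1 : ℝ≥0) := by
    refine hC (fun i t => (b i)⁻¹ * P i t) (fun i => (b i)⁻¹) (fun _ => (m : ℝ)⁻¹) w _ 1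
      (fun i => by simpa using (hP i).const_mul (b i)⁻¹) (hωm.pow_const _) hpos (fun l => ?_) hw
      (fun s hs t => ?_)
    · rw [← Finset.mul_sum, ← Nat.cast_sum, hsum, inv_mul_cancel₀ hm'.ne']
    -- The w_l have mass zero, so every exponent vector in the cube sums to k/m and the product is
    -- at most ω^(k/m).
    · have h1 : ∑ i, ((m : ℝ)⁻¹ + ∑ l, s l * w l i) = k / m := by
        rw [Finset.sum_add_distrib, Finset.sum_comm]
        simp only [← Finset.mul_sum, hw0]
        simp [div_eq_mul_inv]
      have h2 := prod_rpow_le_rpow_sum Finset.univ (fun i => ‖(b i)⁻¹ * P i t‖ₑ) _ (hω0 t)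
        (hωtop t) (fun i _ => hωle t i) (fun i _ => (hpos s hs i).le)
      rw [h1] at h2
      refine (mul_le_mul_right h2 _).trans ?_
      rw [← ENNReal.rpow_add _ _ (hω0 t) (hωtop t)]
      simp
  have hH' : ∫⁻ t, ω t ^ (-(k / m : ℝ)) ≤ C * (∏ i, ENNReal.ofReal (b i)) ^ (m : ℝ)⁻¹ := by
    have h1 : ∏ i, ‖(b i)⁻¹‖ₑ ^ (m : ℝ)⁻¹ = ((∏ i, ENNReal.ofReal (b i)) ^ (m : ℝ)⁻¹)⁻¹ := by
      rw [ENNReal.prod_rpow_of_nonneg (inv_nonneg.2 hm'.le), ← ENNReal.inv_rpow,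
        ENNReal.prod_inv_distrib]
      · congr 1
        refine Finset.prod_congr rfl fun i _ => ?_
        rw [Real.enorm_eq_ofReal (inv_nonneg.2 (hb i).le), ENNReal.ofReal_inv_of_pos (hb i)]
      · intro i _ j _ _
        exact Or.inr ENNReal.ofReal_ne_top
    rw [h1, ← div_eq_mul_inv, ENNReal.coe_one, mul_one] at hH
    refine (ENNReal.div_le_iff_le_mul (Or.inl ?_) (Or.inl ?_)).1 hH
    · refine (ENNReal.rpow_pos ?_ (ENNReal.prod_ne_top fun i _ => ENNReal.ofReal_ne_top)).ne'
      exact pos_iff_ne_zero.2 (Finset.prod_ne_zero_iff.2 fun i _ => by simpa using hb i)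
    · exact ENNReal.rpow_ne_top_of_nonneg (inv_nonneg.2 hm'.le)
        (ENNReal.prod_ne_top fun i _ => ENNReal.ofReal_ne_top)
  set p : ℝ := ((m : ℝ) + k) / k with hp
  have hp0 : 0 < p := by positivity
  have hpq : p.HolderConjugate (((m : ℝ) + k) / m) := by
    rw [Real.holderConjugate_iff]
    refine ⟨?_, ?_⟩
    · rw [hp, one_lt_div hk']; linarith
    · rw [hp]; field_simp; ring
  have hhol := ENNReal.lintegral_mul_le_Lp_mul_Lq volume hpq
    (f := fun t => g t * ω t ^ (1 / p)) (g := fun t => ω t ^ (-(1 / p)))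
    (by fun_prop) (by fun_prop)
  have h1 : ∀ t, ((fun t => g t * ω t ^ (1 / p)) * fun t => ω t ^ (-(1 / p))) t = g t := by
    intro t
    simp only [Pi.mul_apply]
    rw [mul_assoc, ← ENNReal.rpow_add _ _ (hω0 t) (hωtop t)]
    simp
  have h2 : ∀ t, (g t * ω t ^ (1 / p)) ^ p = g t ^ p * ω t := by
    intro t
    rw [ENNReal.mul_rpow_of_nonneg _ _ hp0.le, ← ENNReal.rpow_mul, one_div,
      inv_mul_cancel₀ hp0.ne', ENNReal.rpow_one]
  have h3 : ∀ t, (ω t ^ (-(1 / p))) ^ (((m : ℝ) + k) / m) = ω t ^ (-(k / m : ℝ)) := by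
    intro t
    rw [← ENNReal.rpow_mul]
    congr 1
    rw [hp]; field_simp
  simp only [h1, h2, h3] at hhol
  have h4 : ∫⁻ t, g t ^ p * ω t ≤ k := by
    calc ∫⁻ t, g t ^ p * ω t = ∑ i, ‖(b i)⁻¹‖ₑ * ∫⁻ t, g t ^ p * ‖P i t‖ₑ := by
          have : ∀ t, g t ^ p * ω t = ∑ i, ‖(b i)⁻¹‖ₑ * (g t ^ p * ‖P i t‖ₑ) := by
            intro t
            rw [hω, Finset.mul_sum]
            refine Finset.sum_congr rfl fun i _ => ?_
            rw [enorm_mul]; ring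
          simp only [this]
          rw [lintegral_finsetSum]
          · refine Finset.sum_congr rfl fun i _ => ?_
            rw [lintegral_const_mul' _ _ enorm_ne_top]
          · intro i _
            have := hPm i
            fun_prop
      _ ≤ ∑ i, ENNReal.ofReal (b i)⁻¹ * ENNReal.ofReal (b i) := by
          gcongr with i
          · rw [Real.enorm_eq_ofReal (inv_nonneg.2 (hb i).le)]
          · exact hgb i
      _ = k := by
          have : ∀ i, ENNReal.ofReal (b i)⁻¹ * ENNReal.ofReal (b i) = 1 := fun i => by
            rw [← ENNReal.ofReal_mul (inv_nonneg.2 (hb i).le), inv_mul_cancel₀ (hb i).ne',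
              ENNReal.ofReal_one]
          simp [this]
  calc (∫⁻ t, g t) ^ ((m : ℝ) + k)
      ≤ ((k : ℝ≥0∞) ^ (1 / p) * (C * (∏ i, ENNReal.ofReal (b i)) ^ (m : ℝ)⁻¹) ^
          (1 / (((m : ℝ) + k) / m))) ^ ((m : ℝ) + k) := by
        gcongr
        refine hhol.trans ?_
        gcongr
    _ = _ := by
        rw [ENNReal.mul_rpow_of_nonneg _ _ (by positivity), ← ENNReal.rpow_mul, ← ENNReal.rpow_mul,
          show 1 / p * ((m : ℝ) + k) = k by rw [hp]; field_simp,
          show 1 / (((m : ℝ) + k) / m) * ((m : ℝ) + k) = m by field_simp,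
          ENNReal.mul_rpow_of_nonneg _ _ hm'.le, ← ENNReal.rpow_mul, inv_mul_cancel₀ hm'.ne',
          ENNReal.rpow_one, ENNReal.coe_mul, ENNReal.coe_rpow_of_nonneg _ hk'.le,
          ENNReal.coe_rpow_of_nonneg _ hm'.le, mul_assoc]
        simp

/-- The infimum of the integrals `∫ G |P|` over all `P` with leading term `t ^ β`. -/
noncomputable def leadInf {n : ℕ} (β : Fin n → ℕ) (G : (Fin n → ℝ) → ℝ≥0∞) : ℝ≥0∞ :=
  ⨅ P : {P : (Fin n → ℝ) → ℝ // LexLead n β 1 P ∧ Measurable P}, ∫⁻ t, G t * ‖P.1 t‖ₑ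

/-- Homogeneity: divide P by c. The case c = 0 occurs when the minor determinant vanishes. -/
lemma mul_leadInf_le {n : ℕ} {β : Fin n → ℕ} (G : (Fin n → ℝ) → ℝ≥0∞) {c : ℝ}
    {P : (Fin n → ℝ) → ℝ} (hP : LexLead n β c P) (hPm : Measurable P) :
    ‖c‖ₑ * leadInf β G ≤ ∫⁻ t, G t * ‖P t‖ₑ := by
  by_cases hc : c = 0
  · simp [hc]
  have h1 : LexLead n β 1 fun t => c⁻¹ * P t := by
    simpa [inv_mul_cancel₀ hc] using hP.const_mul c⁻¹
  calc ‖c‖ₑ * leadInf β G ≤ ‖c‖ₑ * ∫⁻ t, G t * ‖c⁻¹ * P t‖ₑ := by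
        gcongr
        exact iInf_le (fun P : {P : (Fin n → ℝ) → ℝ // LexLead n β 1 P ∧ Measurable P} =>
          ∫⁻ t, G t * ‖P.1 t‖ₑ) ⟨_, h1, hPm.const_mul _⟩
    _ = ∫⁻ t, ‖c‖ₑ * (G t * ‖c⁻¹ * P t‖ₑ) := (lintegral_const_mul' _ _ enorm_ne_top).symm
    _ = _ := by
        refine lintegral_congr fun t => ?_
        rw [mul_left_comm, ← enorm_mul, mul_inv_cancel_left₀ hc]

lemma exists_lintegral_rpow_le_prod_leadInf {n k m : ℕ} (hk : 0 < k) (hm : 0 < m)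
    (β : Fin k → Fin n → ℕ) (i₀ : Fin k) (h0 : β i₀ = 0)
    (hspan : Submodule.span ℝ (Set.range fun (i : Fin k) (l : Fin n) => (β i l : ℝ)) = ⊤)
    (hsum : ∀ l, ∑ i, β i l = m) :
    ∃ C : ℝ≥0, ∀ g : (Fin n → ℝ) → ℝ≥0∞, Measurable g →
      (∀ i, leadInf (β i) (fun t => g t ^ (((m : ℝ) + k) / k)) ≠ ∞) →
      (∫⁻ t, g t) ^ ((m : ℝ) + k) ≤ C * ∏ i, leadInf (β i) fun t => g t ^ (((m : ℝ) + k) / k) := by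
  obtain ⟨C, hC⟩ := exists_lintegral_rpow_le_prod hk hm β i₀ h0 hspan hsum
  refine ⟨C, fun g hg hfin => ?_⟩
  set L : Fin k → ℝ≥0∞ := fun i => leadInf (β i) fun t => g t ^ (((m : ℝ) + k) / k) with hL
  -- The infimum may be zero or unattained; ε supplies near-minimisers with positive bounds b_i.
  have key : ∀ ε : ℝ, 0 < ε →
      (∫⁻ t, g t) ^ ((m : ℝ) + k) ≤ C * ENNReal.ofReal (∏ i, ((L i).toReal + ε)) := by
    intro ε hε
    have hlt : ∀ i, L i < ENNReal.ofReal ((L i).toReal + ε) := by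
      intro i
      rw [ENNReal.lt_ofReal_iff_toReal_lt (hfin i)]
      linarith
    choose P hP using fun i => iInf_lt_iff.1 (hlt i)
    rw [ENNReal.ofReal_prod_of_nonneg fun i _ => by positivity]
    exact hC (fun i => (P i).1) g _ (fun i => (P i).2.1) (fun i => (P i).2.2) hg
      (fun i => by positivity) fun i => (hP i).le
  have hlim : Filter.Tendsto (fun ε : ℝ => (C : ℝ≥0∞) * ENNReal.ofReal (∏ i, ((L i).toReal + ε)))
      (nhdsWithin 0 (Set.Ioi 0)) (nhds (C * ENNReal.ofReal (∏ i, ((L i).toReal + 0)))) := by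
    refine ENNReal.Tendsto.const_mul (ENNReal.tendsto_ofReal ?_) (Or.inr ENNReal.coe_ne_top)
    refine Filter.Tendsto.mono_left (Continuous.tendsto ?_ _) nhdsWithin_le_nhds
    fun_prop
  refine (ge_of_tendsto hlim (Filter.eventually_of_mem self_mem_nhdsWithin key)).trans (le_of_eq ?_)
  rw [ENNReal.ofReal_prod_of_nonneg fun i _ => by positivity]
  congr 1
  refine Finset.prod_congr rfl fun i _ => ?_
  rw [add_zero, ENNReal.ofReal_toReal (hfin i)]

end Nonconcentration
-- Generalized Vandermonde determinants
section Determinant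

lemma lintegral_fin_snoc {X : Type*} [MeasureSpace X] [SigmaFinite (volume : Measure X)] {k : ℕ}
    {Φ : (Fin (k + 1) → X) → ℝ≥0∞} (hΦ : Measurable Φ) :
    ∫⁻ t, Φ t = ∫⁻ t : Fin k → X, ∫⁻ x : X, Φ (Fin.snoc t x) := by
  have hmp := (volume_preserving_piFinSuccAbove (fun _ : Fin (k + 1) => X) (Fin.last k)).symm
  rw [← hmp.lintegral_comp_emb (MeasurableEquiv.measurableEmbedding _), Measure.volume_eq_prod,
    lintegral_prod_symm]
  · simp [MeasurableEquiv.piFinSuccAbove, Fin.insertNthEquiv]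
  · exact (hΦ.comp (MeasurableEquiv.measurable _)).aemeasurable

lemma lintegral_fin_prod {X : Type*} [MeasureSpace X] [SigmaFinite (volume : Measure X)] :
    ∀ {k : ℕ} (F : Fin k → X → ℝ≥0∞), (∀ i, Measurable (F i)) →
      ∫⁻ t : Fin k → X, ∏ i, F i (t i) = ∏ i, ∫⁻ x, F i x
  | 0, F, _ => by
    simp [volume_pi]
  | k + 1, F, hF => by
    have hm : Measurable fun t : Fin (k + 1) → X => ∏ i, F i (t i) :=
      Finset.measurable_prod _ fun i _ => (hF i).comp (measurable_pi_apply i)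
    rw [lintegral_fin_snoc hm, Fin.prod_univ_castSucc]
    simp only [Fin.prod_univ_castSucc, Fin.snoc_castSucc, Fin.snoc_last]
    have h1 : ∀ t : Fin k → X, ∫⁻ x, (∏ i : Fin k, F i.castSucc (t i)) * F (Fin.last k) x =
        (∏ i : Fin k, F i.castSucc (t i)) * ∫⁻ x, F (Fin.last k) x := fun t =>
      lintegral_const_mul _ (hF _)
    simp only [h1]
    rw [lintegral_mul_const _ (Finset.measurable_prod _ fun i _ =>
      (hF i.castSucc).comp (measurable_pi_apply i)),
      lintegral_fin_prod (fun i : Fin k => F i.castSucc) fun i => hF i.castSucc]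

lemma continuous_monomial {n : ℕ} (α : Fin n → ℕ) :
    Continuous fun t : Fin n → ℝ => monomial t α := by
  unfold monomial
  fun_prop

/-- The product over `j` of the generalized Vandermonde determinants with exponents `α j`. -/
noncomputable def vandermonde {n k : ℕ} {J : Type*} [Fintype J] (α : J → Fin k → Fin n → ℕ)
    (t : Fin k → Fin n → ℝ) : ℝ :=
  ∏ j, (Matrix.of fun a b => monomial (t a) (α j b)).det

lemma continuous_vandermonde {n k : ℕ} {J : Type*} [Fintype J] (α : J → Fin k → Fin n → ℕ) :
    Continuous (vandermonde α) := by
  unfold vandermonde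
  refine continuous_finsetProd _ fun j _ => Continuous.matrix_det ?_
  exact continuous_matrix fun a b => (continuous_monomial _).comp (continuous_apply a)

lemma lexLead_vandermonde_snoc {n k : ℕ} {J : Type*} [Fintype J] (α : J → Fin (k + 1) → Fin n → ℕ)
    (hα : ∀ j, StrictMono fun i => toLex (α j i)) (t : Fin k → Fin n → ℝ) :
    LexLead n (∑ j, α j (Fin.last k)) (vandermonde (fun j i => α j i.castSucc) t)
      fun x => vandermonde α (Fin.snoc t x : Fin (k + 1) → Fin n → ℝ) := by
  refine LexLead.prod Finset.univ fun j _ => ?_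
  convert lexLead_monomial_add_sum (α j (Fin.last k))
    (Matrix.of fun a (b : Fin k) => monomial (t a) (α j b.castSucc)).det Finset.univ
    (fun i : Fin k => α j i.castSucc)
    (fun b : Fin k => (-1) ^ (k + b : ℕ) *
      (Matrix.of fun (a : Fin k) (c : Fin k) =>
        monomial (t a) (α j (b.castSucc.succAbove c))).det)
    (fun i _ => hα j (Fin.castSucc_lt_last i)) using 1
  funext x
  -- Expansion along the row of the last point: the other minors multiply dictionary-smaller
  -- monomials.
  rw [Matrix.det_succ_row _ (Fin.last k), Fin.sum_univ_castSucc, add_comm]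
  have hsub : ∀ b : Fin (k + 1), (Matrix.of fun a b => monomial
      ((Fin.snoc t x : Fin (k + 1) → Fin n → ℝ) a) (α j b)).submatrix
        (Fin.last k).succAbove b.succAbove =
      Matrix.of fun (a : Fin k) (c : Fin k) => monomial (t a) (α j (b.succAbove c)) := by
    intro b
    ext a c
    simp
  simp only [hsub]
  simp only [Matrix.of_apply, Fin.snoc_last, Fin.val_last, Fin.val_castSucc, Fin.succAbove_last]
  congr 1
  · rw [Even.neg_one_pow ⟨k, rfl⟩]
    ring
  · exact Finset.sum_congr rfl fun b _ => by ring

/-- Integrate out the last point first: its integral is at least `leadInf` times the determinant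
product of the remaining points. -/
lemma prod_leadInf_le {n : ℕ} {J : Type*} [Fintype J] {G : (Fin n → ℝ) → ℝ≥0∞} (hG : Measurable G) :
    ∀ {k : ℕ} (α : J → Fin k → Fin n → ℕ), (∀ j, StrictMono fun i => toLex (α j i)) →
      ∏ i, leadInf (∑ j, α j i) G ≤ ∫⁻ t : Fin k → Fin n → ℝ, (∏ i, G (t i)) * ‖vandermonde α t‖ₑ
  | 0, α, _ => by
    simp [volume_pi, vandermonde]
  | k + 1, α, hα => by
    have hm : ∀ (l : ℕ) (γ : J → Fin l → Fin n → ℕ), Measurable fun t : Fin l → Fin n → ℝ =>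
        (∏ i, G (t i)) * ‖vandermonde γ t‖ₑ := fun l γ =>
      (Finset.measurable_prod _ fun i _ => hG.comp (measurable_pi_apply i)).mul
        (continuous_vandermonde γ).measurable.enorm
    rw [lintegral_fin_snoc (hm _ α), Fin.prod_univ_castSucc]
    refine (mul_le_mul_left (prod_leadInf_le hG (fun j i => α j i.castSucc)
      fun j a b hab => hα j (Fin.castSucc_lt_castSucc_iff.2 hab)) _).trans ?_
    rw [← lintegral_mul_const _ (hm _ _)]
    refine lintegral_mono fun t => ?_
    simp only [Fin.prod_univ_castSucc, Fin.snoc_castSucc, Fin.snoc_last, mul_assoc]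
    have hsm : Measurable fun x : Fin n → ℝ =>
        vandermonde α (Fin.snoc t x : Fin (k + 1) → Fin n → ℝ) := by
      refine (continuous_vandermonde α).measurable.comp (measurable_pi_iff.2 fun l => ?_)
      induction l using Fin.lastCases with
      | last => simpa using measurable_id'
      | cast l => simp
    rw [lintegral_const_mul]
    · exact mul_le_mul_right (mul_leadInf_le G (lexLead_vandermonde_snoc α hα t) hsm) _
    · exact hG.mul hsm.enorm

/-- Lower bound for the determinant functional in terms of `∫ g`. -/
lemma exists_lintegral_rpow_le_vandermonde {n k m : ℕ} {J : Type*} [Fintype J] (hk : 0 < k)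
    (hm : 0 < m) (α : J → Fin k → Fin n → ℕ) (hα : ∀ j, StrictMono fun i => toLex (α j i))
    (i₀ : Fin k) (h0 : ∑ j, α j i₀ = 0)
    (hspan : Submodule.span ℝ (Set.range fun (i : Fin k) (l : Fin n) =>
      ((∑ j, α j i) l : ℝ)) = ⊤)
    (hsum : ∀ l, ∑ i, (∑ j, α j i) l = m) :
    ∃ C : ℝ≥0, ∀ g : (Fin n → ℝ) → ℝ≥0∞, Measurable g →
      (∫⁻ t, g t) ^ ((m : ℝ) + k) ≤ C * ∫⁻ t : Fin k → Fin n → ℝ,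
        (∏ i, g (t i) ^ (((m : ℝ) + k) / k)) * ‖vandermonde α t‖ₑ := by
  obtain ⟨C, hC⟩ := exists_lintegral_rpow_le_prod_leadInf hk hm (fun i => ∑ j, α j i) i₀ h0 hspan hsum
  refine ⟨C, fun g hg => ?_⟩
  have hk' : (0 : ℝ) < k := by exact_mod_cast hk
  have hp : 0 < ((m : ℝ) + k) / k := by positivity
  -- Truncation in size and support makes each infimum finite, with t^β as competitor; monotone
  -- convergence then recovers g.
  set gN : ℕ → (Fin n → ℝ) → ℝ≥0∞ := fun N =>
    (Metric.closedBall 0 N).indicator fun t => min (g t) N with hgN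
  have hgNm : ∀ N, Measurable (gN N) := fun N =>
    (hg.min measurable_const).indicator Metric.isClosed_closedBall.measurableSet
  have hgNle : ∀ N t, gN N t ≤ g t := fun N t =>
    Set.indicator_apply_le' (fun _ => min_le_left _ _) fun _ => zero_le
  have hfin : ∀ N i, leadInf (∑ j, α j i) (fun t => gN N t ^ (((m : ℝ) + k) / k)) ≠ ∞ := by
    intro N i
    refine ne_top_of_le_ne_top ?_ (iInf_le _ ⟨fun t => monomial t (∑ j, α j i), ?_,
      (continuous_monomial _).measurable⟩)
    · obtain ⟨M, hM⟩ := (isCompact_closedBall (0 : Fin n → ℝ) N).exists_bound_of_continuousOn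
        (continuous_monomial (∑ j, α j i)).continuousOn
      have hle : ∫⁻ t, gN N t ^ (((m : ℝ) + k) / k) * ‖monomial t (∑ j, α j i)‖ₑ ≤
          ∫⁻ t in Metric.closedBall (0 : Fin n → ℝ) N,
            (N : ℝ≥0∞) ^ (((m : ℝ) + k) / k) * ENNReal.ofReal M := by
        rw [← lintegral_indicator Metric.isClosed_closedBall.measurableSet]
        refine lintegral_mono fun t => ?_
        by_cases ht : t ∈ Metric.closedBall (0 : Fin n → ℝ) N
        · simp only [hgN, Set.indicator_of_mem ht]
          gcongr
          · exact min_le_right _ _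
          · rw [← ofReal_norm]
            exact ENNReal.ofReal_le_ofReal (hM t ht)
        · simp [hgN, Set.indicator_of_notMem ht, ENNReal.zero_rpow_of_pos hp]
      refine ne_top_of_le_ne_top ?_ hle
      rw [setLIntegral_const]
      exact ENNReal.mul_ne_top (ENNReal.mul_ne_top (ENNReal.rpow_ne_top_of_nonneg hp.le
        (ENNReal.natCast_ne_top N)) ENNReal.ofReal_ne_top) (isCompact_closedBall _ _).measure_lt_top.ne
    · simpa using lexLead_monomial_add_sum (∑ j, α j i) 1 (∅ : Finset ℕ) (fun _ => 0) (fun _ => 0)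
        (by simp)
  have hbound : ∀ N, (∫⁻ t, gN N t) ^ ((m : ℝ) + k) ≤ C * ∫⁻ t : Fin k → Fin n → ℝ,
        (∏ i, g (t i) ^ (((m : ℝ) + k) / k)) * ‖vandermonde α t‖ₑ := by
    intro N
    refine (hC (gN N) (hgNm N) (hfin N)).trans ?_
    gcongr
    refine (prod_leadInf_le ((hgNm N).pow_const _) α hα).trans ?_
    gcongr with t i
    exact hgNle N _
  have hmono : Monotone gN := by
    intro N M hNM t
    by_cases ht : t ∈ Metric.closedBall (0 : Fin n → ℝ) N
    · have hNM' : (N : ℝ) ≤ M := by exact_mod_cast hNM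
      simp only [hgN, Set.indicator_of_mem ht,
        Set.indicator_of_mem (Metric.closedBall_subset_closedBall hNM' ht)]
      gcongr
    · simp [hgN, Set.indicator_of_notMem ht]
  have hsup : ∀ t, ⨆ N, gN N t = g t := by
    intro t
    refine le_antisymm (iSup_le fun N => hgNle N t) (le_of_forall_lt fun a ha => ?_)
    obtain ⟨N₁, hN₁⟩ := ENNReal.exists_nat_gt ha.ne_top
    obtain ⟨N₂, hN₂⟩ := exists_nat_ge ‖t‖
    refine lt_iSup_iff.2 ⟨max N₁ N₂, ?_⟩
    have ht : t ∈ Metric.closedBall (0 : Fin n → ℝ) (max N₁ N₂ : ℕ) := by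
      rw [mem_closedBall_zero_iff]
      exact hN₂.trans (by exact_mod_cast le_max_right _ _)
    simp only [hgN, Set.indicator_of_mem ht]
    exact lt_min ha (hN₁.trans_le (by exact_mod_cast le_max_left _ _))
  have hconv : ∫⁻ t, g t = ⨆ N, ∫⁻ t, gN N t := by
    rw [← lintegral_iSup hgNm hmono]
    simp only [hsup]
  have hmk : 0 < (m : ℝ) + k := by positivity
  rw [← ENNReal.le_rpow_inv_iff hmk, hconv]
  exact iSup_le fun N => (ENNReal.le_rpow_inv_iff hmk).2 (hbound N)

end Determinant
-- Change of variables in the coefficients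
section Averaging

variable {n n' k m : ℕ} {A : Finset ((Fin n → ℕ) × Fin n')}

lemma volume_preserving_curry (ι κ : Type*) [Fintype ι] [Fintype κ] :
    MeasurePreserving (MeasurableEquiv.curry ι κ ℝ) := by
  refine MeasurePreserving.symm (MeasurableEquiv.curry ι κ ℝ).symm ⟨MeasurableEquiv.measurable _, ?_⟩
  rw [volume_pi (ι := ι × κ)]
  refine (Measure.pi_eq fun s hs => ?_).symm
  rw [MeasurableEquiv.map_apply]
  have : (MeasurableEquiv.curry ι κ ℝ).symm ⁻¹' Set.univ.pi s =
      Set.univ.pi fun i => Set.univ.pi fun j => s (i, j) := by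
    ext z
    simp [MeasurableEquiv.coe_curry_symm, Function.uncurry]
  rw [this, volume_pi_pi]
  simp only [volume_pi_pi, Fintype.prod_prod_type]

/-- The `i`-th multiindex of the `j`-th slice, in the dictionary order. -/
noncomputable def sliceEnum (A : Finset ((Fin n → ℕ) × Fin n')) (h : ∀ j, (slice A j).card = k)
    (j : Fin n') (i : Fin k) : Fin n → ℕ :=
  ofLex ((lexSlice A j).orderEmbOfFin ((card_lexSlice A j).trans (h j)) i)

lemma sliceEnum_strictMono (h : ∀ j, (slice A j).card = k) (j : Fin n') :
    StrictMono fun i => toLex (sliceEnum A h j i) :=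
  ((lexSlice A j).orderEmbOfFin ((card_lexSlice A j).trans (h j))).strictMono

lemma mem_slice_iff {j : Fin n'} {α : Fin n → ℕ} : α ∈ slice A j ↔ (α, j) ∈ A := by
  simp only [slice, Finset.mem_image, Finset.mem_filter]
  constructor
  · rintro ⟨⟨a, b⟩, ⟨h1, h2⟩, h3⟩
    simp only at h2 h3
    rwa [← h2, ← h3]
  · intro h
    exact ⟨_, ⟨h, rfl⟩, rfl⟩

lemma exists_sliceEnum_eq_iff (h : ∀ j, (slice A j).card = k) (j : Fin n') (α : Fin n → ℕ) :
    (∃ i, sliceEnum A h j i = α) ↔ (α, j) ∈ A := by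
  have h1 : toLex α ∈ lexSlice A j ↔ α ∈ slice A j := by simp [lexSlice]
  rw [← mem_slice_iff, ← h1, ← Finset.mem_coe,
    ← Finset.range_orderEmbOfFin (lexSlice A j) ((card_lexSlice A j).trans (h j))]
  exact Iff.rfl

lemma sum_sliceEnum (h : ∀ j, (slice A j).card = k) (j : Fin n') :
    ∑ i, sliceEnum A h j i = ∑ α ∈ slice A j, α := by
  refine Finset.sum_bij (fun i _ => sliceEnum A h j i) (fun i _ => ?_) (fun i _ i' _ hii => ?_)
    (fun α hα => ?_) fun _ _ => rfl
  · exact mem_slice_iff.2 ((exists_sliceEnum_eq_iff h j _).1 ⟨i, rfl⟩)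
  · exact (sliceEnum_strictMono h j).injective hii
  · obtain ⟨i, hi⟩ := (exists_sliceEnum_eq_iff h j α).2 (mem_slice_iff.1 hα)
    exact ⟨i, Finset.mem_univ i, hi⟩

lemma sliceEnum_zero (h : ∀ j, (slice A j).card = k) (hk : 0 < k) (j : Fin n')
    (h0 : (0 : Fin n → ℕ) ∈ slice A j) : sliceEnum A h j ⟨0, hk⟩ = 0 := by
  obtain ⟨i, hi⟩ := (exists_sliceEnum_eq_iff h j 0).2 (mem_slice_iff.1 h0)
  have h1 : toLex (sliceEnum A h j ⟨0, hk⟩) ≤ toLex (sliceEnum A h j i) :=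
    (sliceEnum_strictMono h j).monotone (Nat.zero_le i)
  rw [hi] at h1
  exact toLex.injective (le_antisymm h1 (Pi.toLex_monotone fun _ => Nat.zero_le _))

/-- The enumeration of `A` by position in the slice and slice number. -/
noncomputable def indexEquiv (h : ∀ j, (slice A j).card = k) : Fin k × Fin n' ≃ A :=
  Equiv.ofBijective (fun x => ⟨(sliceEnum A h x.2 x.1, x.2),
    (exists_sliceEnum_eq_iff h x.2 _).1 ⟨x.1, rfl⟩⟩) <| by
    constructor
    · rintro ⟨i, j⟩ ⟨i', j'⟩ hx
      simp only [Subtype.mk.injEq, Prod.mk.injEq] at hx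
      obtain ⟨h1, rfl⟩ := hx
      rw [(sliceEnum_strictMono h j).injective h1]
    · rintro ⟨⟨α, j⟩, hα⟩
      obtain ⟨i, rfl⟩ := (exists_sliceEnum_eq_iff h j α).2 hα
      exact ⟨(i, j), rfl⟩

lemma graphPoint_snd (h : ∀ j, (slice A j).card = k) (u : A → ℝ) (t : Fin n → ℝ) (j : Fin n') :
    (graphPoint A u t).2 j = ∑ i, u (indexEquiv h (i, j)) * monomial t (sliceEnum A h j i) := by
  simp only [graphPoint]
  rw [Finset.sum_filter, ← (indexEquiv h).sum_comp, Fintype.sum_prod_type]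
  refine Finset.sum_congr rfl fun i _ => ?_
  exact (Finset.sum_eq_single j (fun j' _ hj => if_neg hj) fun hj =>
    absurd (Finset.mem_univ j) hj).trans (if_pos rfl)

lemma enorm_vandermonde_mul_lintegral_le (h : ∀ j, (slice A j).card = k) (t : Fin k → Fin n → ℝ)
    (F : Fin k → (Fin n' → ℝ) → ℝ≥0∞) (hF : ∀ i, Measurable (F i)) :
    ‖vandermonde (sliceEnum A h) t‖ₑ * ∫⁻ u : A → ℝ, ∏ i, F i (graphPoint A u (t i)).2 ≤
      ∏ i, ∫⁻ y, F i y := by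
  by_cases hJ : vandermonde (sliceEnum A h) t = 0
  · simp [hJ]
  -- Coefficients of slice j affect only coordinate j, so the linear map is block diagonal.
  set M : Matrix (Fin k × Fin n') (Fin k × Fin n') ℝ := Matrix.blockDiagonal fun j =>
    Matrix.of fun a b => monomial (t a) (sliceEnum A h j b) with hM
  have hdet : M.det = vandermonde (sliceEnum A h) t := Matrix.det_blockDiagonal _
  set Ψ : (Fin k × Fin n' → ℝ) → ℝ≥0∞ := fun z => ∏ i, F i fun j => z (i, j) with hΨ
  have hΨm : Measurable Ψ := Finset.measurable_prod _ fun i _ =>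
    (hF i).comp (measurable_pi_iff.2 fun j => measurable_pi_apply (i, j))
  have h1 : ∫⁻ u : A → ℝ, ∏ i, F i (graphPoint A u (t i)).2 =
      ∫⁻ w, Ψ (Matrix.toLin' M w) := by
    rw [← (volume_measurePreserving_piCongrLeft (fun _ : A => ℝ)
      (indexEquiv h)).lintegral_comp_emb (MeasurableEquiv.measurableEmbedding _)]
    refine lintegral_congr fun w => Finset.prod_congr rfl fun i _ => congrArg (F i) ?_
    funext j
    rw [graphPoint_snd h, Matrix.toLin'_apply, Matrix.mulVec, dotProduct, Fintype.sum_prod_type]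
    refine Finset.sum_congr rfl fun i' _ => ?_
    simp [hM, Matrix.blockDiagonal_apply, MeasurableEquiv.coe_piCongrLeft,
      Equiv.piCongrLeft_apply_apply, mul_comm]
  have h2 : ∫⁻ w, Ψ (Matrix.toLin' M w) = ENNReal.ofReal |M.det⁻¹| * ∫⁻ z, Ψ z := by
    rw [← lintegral_map hΨm (LinearMap.continuous_of_finiteDimensional _).measurable,
      Real.map_matrix_volume_pi_eq_smul_volume_pi (hdet ▸ hJ), lintegral_smul_measure, smul_eq_mul]
  have h3 : ∫⁻ z, Ψ z = ∏ i, ∫⁻ y, F i y := by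
    rw [← lintegral_fin_prod F hF, ← (volume_preserving_curry (Fin k) (Fin n')).lintegral_comp_emb
      (MeasurableEquiv.measurableEmbedding _)]
    rfl
  rw [h1, h2, h3, ← mul_assoc, hdet, Real.enorm_eq_ofReal_abs, ← ENNReal.ofReal_mul (abs_nonneg _),
    ← abs_mul, mul_inv_cancel₀ hJ]
  simp

lemma continuous_graphPoint (A : Finset ((Fin n → ℕ) × Fin n')) :
    Continuous fun x : (A → ℝ) × (Fin n → ℝ) => graphPoint A x.1 x.2 := by
  unfold graphPoint monomial
  fun_prop

lemma IsAdmissible.exists_lintegral_rpow_le (hn : 0 < n) (hn' : 0 < n') (hA : IsAdmissible A k m) :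
    0 < k ∧ ∃ C : ℝ≥0, ∀ F : (Fin n → ℝ) × (Fin n' → ℝ) → ℝ≥0∞, Measurable F →
      ∫⁻ u : A → ℝ, (∫⁻ t, F (graphPoint A u t)) ^ ((m : ℝ) + k) ≤
        C * (∫⁻ x, F x ^ (((m : ℝ) + k) / k)) ^ k := by
  have h := hA.dimensionality
  have hk : 0 < k := by
    rw [← h ⟨0, hn'⟩]
    exact Finset.card_pos.2 ⟨0, hA.nondegeneracy _⟩
  refine ⟨hk, ?_⟩
  have hsum : ∀ l, ∑ i, (∑ j, sliceEnum A h j i) l = m := by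
    intro l
    rw [← Finset.sum_apply, Finset.sum_comm]
    simp only [sum_sliceEnum, hA.scaling]
  have hspan : Submodule.span ℝ (Set.range fun (i : Fin k) (l : Fin n) =>
      ((∑ j, sliceEnum A h j i) l : ℝ)) = ⊤ := hA.spanning
  -- If m = 0, all β_i vanish and cannot span ℝⁿ with n > 0.
  have hm : 0 < m := by
    rw [Nat.pos_iff_ne_zero]
    rintro rfl
    have h0 : ∀ i l, (∑ j, sliceEnum A h j i) l = 0 := fun i l =>
      Finset.sum_eq_zero_iff.1 (hsum l) i (Finset.mem_univ i)
    have h1 : (fun _ => 1 : Fin n → ℝ) ∈ Submodule.span ℝ (Set.range fun (i : Fin k) (l : Fin n) =>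
      ((∑ j, sliceEnum A h j i) l : ℝ)) := hspan ▸ Submodule.mem_top
    rw [Submodule.span_eq_bot.2] at h1
    · exact one_ne_zero (congrFun ((Submodule.mem_bot ℝ).1 h1) ⟨0, hn⟩)
    · rintro _ ⟨i, rfl⟩
      funext l
      simp only [h0, Nat.cast_zero, Pi.zero_apply]
  obtain ⟨C, hC⟩ := exists_lintegral_rpow_le_vandermonde hk hm (sliceEnum A h)
    (sliceEnum_strictMono h) ⟨0, hk⟩
    (Finset.sum_eq_zero fun j _ => sliceEnum_zero h hk j (hA.nondegeneracy j)) hspan hsum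
  refine ⟨C, fun F hF => ?_⟩
  set p : ℝ := ((m : ℝ) + k) / k with hp
  have hgp : ∀ u : A → ℝ, Measurable fun t => graphPoint A u t := fun u =>
    ((continuous_graphPoint A).comp (by fun_prop : Continuous fun t => (u, t))).measurable
  have hpg : ∀ t, Measurable fun u : A → ℝ => graphPoint A u t := fun t =>
    ((continuous_graphPoint A).comp (by fun_prop : Continuous fun u : A → ℝ => (u, t))).measurable
  have hprodm : Measurable fun x : (A → ℝ) × (Fin k → Fin n → ℝ) =>
      ∏ i, F (graphPoint A x.1 (x.2 i)) ^ p :=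
    Finset.measurable_prod _ fun i _ => (hF.comp ((continuous_graphPoint A).comp
      (by fun_prop : Continuous fun x : (A → ℝ) × (Fin k → Fin n → ℝ) =>
        (x.1, x.2 i))).measurable).pow_const p
  have hVm : Measurable fun t => ‖vandermonde (sliceEnum A h) t‖ₑ :=
    (continuous_vandermonde _).measurable.enorm
  have hFy : ∀ t, Measurable fun y => F (t, y) ^ p := fun t =>
    (hF.comp measurable_prodMk_left).pow_const p
  calc ∫⁻ u : A → ℝ, (∫⁻ t, F (graphPoint A u t)) ^ ((m : ℝ) + k)
      ≤ ∫⁻ u : A → ℝ, C * ∫⁻ t : Fin k → Fin n → ℝ,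
          (∏ i, F (graphPoint A u (t i)) ^ p) * ‖vandermonde (sliceEnum A h) t‖ₑ :=
        lintegral_mono fun u => hC _ (hF.comp (hgp u))
    _ = C * ∫⁻ t : Fin k → Fin n → ℝ, ∫⁻ u : A → ℝ,
          (∏ i, F (graphPoint A u (t i)) ^ p) * ‖vandermonde (sliceEnum A h) t‖ₑ := by
        rw [lintegral_const_mul' _ _ ENNReal.coe_ne_top, lintegral_lintegral_swap]
        exact (hprodm.mul (hVm.comp measurable_snd)).aemeasurable
    _ = C * ∫⁻ t : Fin k → Fin n → ℝ, ‖vandermonde (sliceEnum A h) t‖ₑ * ∫⁻ u : A → ℝ,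
          ∏ i, F (t i, (graphPoint A u (t i)).2) ^ p := by
        congr 1
        refine lintegral_congr fun t => ?_
        rw [lintegral_mul_const' _ _ enorm_ne_top, mul_comm]
        rfl
    _ ≤ C * ∫⁻ t : Fin k → Fin n → ℝ, ∏ i, ∫⁻ y, F (t i, y) ^ p := by
        gcongr with t
        exact enorm_vandermonde_mul_lintegral_le h t (fun i y => F (t i, y) ^ p) fun i => hFy (t i)
    _ = C * (∫⁻ x, F x ^ p) ^ k := by
        have hFp : Measurable fun x => F x ^ p := hF.pow_const p
        rw [lintegral_fin_prod (fun _ : Fin k => fun t => ∫⁻ y, F (t, y) ^ p)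
          fun _ => hFp.lintegral_prod_right', Finset.prod_const, Finset.card_univ, Fintype.card_fin,
          Measure.volume_eq_prod, lintegral_prod _ hFp.aemeasurable]

end Averaging
end PolyAvg

/-! ### From nonnegative measurable functions to L^p classes -/

theorem theorem2 (n n' d : ℕ) (hn : 0 < n) (hn' : 0 < n') (hd : 0 < d)
    (A : Finset ((Fin n → ℕ) × Fin n'))
    (hAd : (A : Set ((Fin n → ℕ) × Fin n')) ⊆ PolyAvg.multiIndices n d ×ˢ Set.univ)
    (k m : ℕ) (hA : PolyAvg.IsAdmissible A k m) :
    ∃ C : ℝ≥0, ∀ f : (Fin n → ℝ) × (Fin n' → ℝ) → ℂ,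
      MemLp f (((m : ℝ≥0∞) + (k : ℝ≥0∞)) / (k : ℝ≥0∞)) volume →
        (∀ᵐ u : A → ℝ, Integrable (fun t : Fin n → ℝ => f (PolyAvg.graphPoint A u t)) volume) ∧
        MemLp (PolyAvg.averagingOp A f) ((m : ℝ≥0∞) + (k : ℝ≥0∞)) volume ∧
        eLpNorm (PolyAvg.averagingOp A f) ((m : ℝ≥0∞) + (k : ℝ≥0∞)) volume ≤
          (C : ℝ≥0∞) * eLpNorm f (((m : ℝ≥0∞) + (k : ℝ≥0∞)) / (k : ℝ≥0∞)) volume := by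
  obtain ⟨hk, C, hC⟩ := hA.exists_lintegral_rpow_le hn hn'
  have hk' : (0 : ℝ) < k := by exact_mod_cast hk
  have hk0 : (k : ℝ≥0∞) ≠ 0 := by exact_mod_cast hk.ne'
  set p : ℝ≥0∞ := ((m : ℝ≥0∞) + (k : ℝ≥0∞)) / (k : ℝ≥0∞) with hp
  set q : ℝ≥0∞ := (m : ℝ≥0∞) + (k : ℝ≥0∞) with hq
  have hq0 : q ≠ 0 := by simp [hq, hk.ne']
  have hqt : q ≠ ∞ := by simp [hq]
  have hp0 : p ≠ 0 := by simp [hp, ENNReal.div_eq_zero_iff, hq0]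
  have hpt : p ≠ ∞ := ENNReal.div_ne_top hqt hk0
  have hqr : q.toReal = (m : ℝ) + k := by simp [hq, ENNReal.toReal_add]
  have hpr : p.toReal = ((m : ℝ) + k) / k := by rw [hp, ENNReal.toReal_div, hqr]; simp
  have hmk : (0 : ℝ) < (m : ℝ) + k := by positivity
  refine ⟨C ^ (1 / ((m : ℝ) + k)), fun f hf => ?_⟩
  obtain ⟨f₀, hf₀, hff₀⟩ := hf.1
  have hmeas : Measurable fun x : (A → ℝ) × (Fin n → ℝ) => PolyAvg.graphPoint A x.1 x.2 :=
    (PolyAvg.continuous_graphPoint A).measurable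
  -- Graphs are themselves null sets, so a change of representative needs care. The estimate applied
  -- to the indicator of a null set shows that almost every graph meets it for almost no t.
  have hae : ∀ᵐ u : A → ℝ, (fun t => f (PolyAvg.graphPoint A u t)) =ᵐ[volume]
      fun t => f₀ (PolyAvg.graphPoint A u t) := by
    set Z := toMeasurable volume {x | f x ≠ f₀ x} with hZ
    have hZ0 : volume Z = 0 := by rw [hZ, measure_toMeasurable]; exact hff₀
    have hZm : MeasurableSet Z := measurableSet_toMeasurable _ _
    have hind : Measurable (Z.indicator (1 : (Fin n → ℝ) × (Fin n' → ℝ) → ℝ≥0∞)) :=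
      measurable_one.indicator hZm
    have hpp : (0 : ℝ) < ((m : ℝ) + k) / k := by positivity
    have h0 : ∫⁻ x, (Z.indicator 1 x : ℝ≥0∞) ^ (((m : ℝ) + k) / k) = 0 := by
      rw [lintegral_eq_zero_iff (hind.pow_const _)]
      filter_upwards [compl_mem_ae_iff.2 hZ0] with x hx
      simp [Set.indicator_of_notMem hx, ENNReal.zero_rpow_of_pos hpp]
    have h1 := hC _ hind
    rw [h0, zero_pow hk.ne', mul_zero, nonpos_iff_eq_zero, lintegral_eq_zero_iff] at h1
    · filter_upwards [h1] with u hu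
      have h2 : ∫⁻ t, Z.indicator (1 : (Fin n → ℝ) × (Fin n' → ℝ) → ℝ≥0∞) (PolyAvg.graphPoint A u t) = 0 := by
        simpa [ENNReal.rpow_eq_zero_iff, hmk, hmk.not_gt] using hu
      have hm : Measurable fun t => Z.indicator (1 : (Fin n → ℝ) × (Fin n' → ℝ) → ℝ≥0∞)
          (PolyAvg.graphPoint A u t) := hind.comp (hmeas.comp measurable_prodMk_left)
      rw [lintegral_eq_zero_iff hm] at h2
      filter_upwards [h2] with t ht
      by_contra hne
      have : PolyAvg.graphPoint A u t ∈ Z := subset_toMeasurable _ _ hne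
      simp [Set.indicator_of_mem this] at ht
    · exact ((hind.comp hmeas).lintegral_prod_right').pow_const _
  have hbound := hC (fun x => ‖f₀ x‖ₑ) hf₀.measurable.enorm
  have hfp : ∫⁻ x, ‖f₀ x‖ₑ ^ (((m : ℝ) + k) / k) = eLpNorm f p volume ^ (((m : ℝ) + k) / k) := by
    rw [eLpNorm_congr_ae hff₀, eLpNorm_eq_lintegral_rpow_enorm_toReal hp0 hpt, hpr,
      ← ENNReal.rpow_mul, one_div, inv_mul_cancel₀ (by positivity), ENNReal.rpow_one]
  have hfin : (C : ℝ≥0∞) * (∫⁻ x, ‖f₀ x‖ₑ ^ (((m : ℝ) + k) / k)) ^ k ≠ ∞ := by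
    rw [hfp]
    exact ENNReal.mul_ne_top ENNReal.coe_ne_top (ENNReal.pow_ne_top
      (ENNReal.rpow_ne_top_of_nonneg (by positivity) hf.2.ne))
  have hNm : Measurable fun u : A → ℝ => ∫⁻ t, ‖f₀ (PolyAvg.graphPoint A u t)‖ₑ :=
    (hf₀.measurable.enorm.comp hmeas).lintegral_prod_right'
  have hint : ∀ᵐ u : A → ℝ, Integrable (fun t => f₀ (PolyAvg.graphPoint A u t)) volume := by
    filter_upwards [ae_lt_top (hNm.pow_const ((m : ℝ) + k)) (ne_top_of_le_ne_top hfin hbound)]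
      with u hu
    refine ⟨(hf₀.comp_measurable (hmeas.comp measurable_prodMk_left)).aestronglyMeasurable, ?_⟩
    exact (ENNReal.rpow_lt_top_iff_of_pos hmk).1 hu
  have hop : PolyAvg.averagingOp A f =ᵐ[volume] PolyAvg.averagingOp A f₀ := by
    filter_upwards [hae] with u hu
    exact integral_congr_ae hu
  have hsm : AEStronglyMeasurable (PolyAvg.averagingOp A f) volume := by
    refine AEStronglyMeasurable.congr ?_ hop.symm
    exact (hf₀.comp_measurable hmeas).integral_prod_right'.aestronglyMeasurable
  have hle : eLpNorm (PolyAvg.averagingOp A f) q volume ≤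
      (C ^ (1 / ((m : ℝ) + k)) : ℝ≥0) * eLpNorm f p volume := by
    rw [eLpNorm_congr_ae hop, eLpNorm_eq_lintegral_rpow_enorm_toReal hq0 hqt, hqr]
    calc (∫⁻ u, ‖PolyAvg.averagingOp A f₀ u‖ₑ ^ ((m : ℝ) + k)) ^ (1 / ((m : ℝ) + k))
        ≤ (C * (eLpNorm f p volume ^ (((m : ℝ) + k) / k)) ^ k) ^ (1 / ((m : ℝ) + k)) := by
          rw [← hfp]
          gcongr
          refine le_trans (lintegral_mono fun u => ?_) hbound
          gcongr
          exact enorm_integral_le_lintegral_enorm _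
      _ = _ := by
          rw [← ENNReal.rpow_natCast, ← ENNReal.rpow_mul, div_mul_cancel₀ _ hk'.ne',
            ENNReal.mul_rpow_of_nonneg _ _ (by positivity), ← ENNReal.rpow_mul,
            mul_one_div_cancel hmk.ne', ENNReal.rpow_one,
            ENNReal.coe_rpow_of_nonneg _ (by positivity)]
  refine ⟨?_, ⟨hsm, hle.trans_lt (ENNReal.mul_lt_top ENNReal.coe_lt_top hf.2)⟩, hle⟩
  filter_upwards [hae, hint] with u hu hi
  exact hi.congr hu.symm
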